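/- Let $2\le n\le N$ be integers and let $Z=(z_{j,r})$ be a complex $N\times n$ matrix. Let $$\mathrm{Per}(Z)=\sum_{j}\prod_{r=1}^n z_{j_r,r},$$ where $j=(j_1,\dots,j_n)$ runs over all $n$-tuples of pairwise distinct elements of $\{1,\dots,N\}$, and for $1\le r\le n$ let $\widetilde z_r=\frac1N\sum_{j=1}^N z_{j,r}$. Set $$\beta=\frac1n\sum_{r=1}^n|\widetilde z_r|^2,\qquad \vartheta=\frac{1}{N(N-1)\sqrt{n(n-1)}}\Bigl(\sum_{(r,s)}\Bigl(\sum_{(u,v)}|z_{u,r}-z_{v,r}|\,|z_{u,s}-z_{v,s}|\Bigr)^2\Bigr)^{1/2},$$ where here and below $(r,s)$ ranges over the ordered pairs of distinct elements of $\{1,\dots,n\}$ and $(u,v)$ over the ordered pairs of distinct elements of $\{1,\dots,N\}$. Let $\kappa=1$ if $n=2$, and if $n\ge 3$ let $$\kappa=\frac{1}{(n-2)(N-2)}\max_{(u,v),\,(r,s)}\ \sum_{j\in\{1,\dots,N\}\setminus\{u,v\}}\ \sum_{\ell\in\{1,\dots,n\}\setminus\{r,s\}}|z_{j,\ell}|^2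 .$$ For $x_1,x_2\in\mathbb R$ let $f_n(x_1,x_2)=\sum_{k=2}^n(k-1)x_1^{n-k}x_2^{k-2}$ (with $x^0=1$ for every $x$, including $x=0$). Then, for all real $x_1\ne x_2$, $$f_n(x_1,x_2)=\frac{(n-1)x_2^{n}-n x_1x_2^{n-1}+x_1^n}{(x_2-x_1)^2},$$ and $$\Bigl|\frac{(N-n)!}{N!}\,\mathrm{Per}(Z)-\prod_{r=1}^n\widetilde z_r\Bigr|\le\frac{\vartheta}{2N}\,f_n\bigl(\sqrt\beta,\sqrt\kappa\bigr).$$ -/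

import Mathlib

namespace PermanentApprox

/-- The permanent of a rectangular `N × n` matrix: the sum over all injective maps
`j : {1,…,n} → {1,…,N}` of the products `∏ r, Z (j r) r`. -/
noncomputable def per {N n : ℕ} (Z : Matrix (Fin N) (Fin n) ℂ) : ℂ :=
  ∑ j : Fin n ↪ Fin N, ∏ r, Z (j r) r

/-- The arithmetic mean of the `r`-th column. -/
noncomputable def colMean {N n : ℕ} (Z : Matrix (Fin N) (Fin n) ℂ) (r : Fin n) : ℂ :=
  (1 / (N : ℂ)) * ∑ j, Z j r

/-- The mean of the squared moduli of the column means. -/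
noncomputable def beta {N n : ℕ} (Z : Matrix (Fin N) (Fin n) ℂ) : ℝ :=
  (1 / (n : ℝ)) * ∑ r, ‖colMean Z r‖ ^ 2

/-- The difference `y_{u,v,r} = z_{u,r} - z_{v,r}`. -/
def rowDiff {N n : ℕ} (Z : Matrix (Fin N) (Fin n) ℂ) (u v : Fin N) (r : Fin n) : ℂ :=
  Z u r - Z v r

/-- The quantity `ϑ`; `Finset.univ.offDiag` is the set of ordered pairs of distinct indices. -/
noncomputable def vartheta {N n : ℕ} (Z : Matrix (Fin N) (Fin n) ℂ) : ℝ :=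
  1 / ((N : ℝ) * ((N : ℝ) - 1) * √((n : ℝ) * ((n : ℝ) - 1))) *
    √(∑ p ∈ (Finset.univ : Finset (Fin n)).offDiag,
      (∑ q ∈ (Finset.univ : Finset (Fin N)).offDiag,
        ‖rowDiff Z q.1 q.2 p.1 * rowDiff Z q.1 q.2 p.2‖) ^ 2)

/-- The quantity `κ`. The supremum is over the finite set of all `(u, v)`, `(r, s)` with `u ≠ v`
and `r ≠ s`, which is nonempty for `2 ≤ n` and `2 ≤ N`, so it is a maximum. -/
noncomputable def kappa {N n : ℕ} (Z : Matrix (Fin N) (Fin n) ℂ) : ℝ :=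
  if 3 ≤ n then
    1 / (((n : ℝ) - 2) * ((N : ℝ) - 2)) *
      ⨆ x : {q : Fin N × Fin N // q.1 ≠ q.2} × {p : Fin n × Fin n // p.1 ≠ p.2},
        ∑ j ∈ Finset.univ \ {x.1.1.1, x.1.1.2},
          ∑ l ∈ Finset.univ \ {x.2.1.1, x.2.1.2}, ‖Z j l‖ ^ 2
  else 1

/-- The polynomial `f_n(x₁, x₂) = ∑_{k=2}^n (k-1) x₁^{n-k} x₂^{k-2}`. -/
def f (n : ℕ) (x₁ x₂ : ℝ) : ℝ :=
  ∑ k ∈ Finset.Icc 2 n, ((k : ℝ) - 1) * x₁ ^ (n - k) * x₂ ^ (k - 2)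

end PermanentApprox

namespace PermanentApprox

open Finset Equiv

/-! Embed the columns into the rows by a fixed `c` and sum over all permutations σ of the rows
instead of over injections; every set K of columns then lives on the same sample space. Let a_k
(`interpolant`) be the average, over the k-sets K of columns, of the normalized permanent of K times
the means of the columns outside K. Then a_0 = a_1 = ∏ means, a_n is the normalized permanent, and
the error telescopes into the increments a_{k+2} - a_{k+1} with 0 ≤ k ≤ n - 2.

Exchanging a column factor for its column mean costs, after symmetrizing under a transposition, only
-1/(2N) times sums that contain a product of two row differences (`two_mul_card_mul_sum_perm_sub`).

To bound an increment, fix the rows (u, v) hit by the two distinguished columns. The remaining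
product of moduli is at most, on average, the product of the quadratic means of its columns over the
other rows (`sum_prod_le_card_mul_prod_sqrt`). Cauchy–Schwarz over the remaining columns, then over
the pair (r, s), separates the three quantities ϑ, κ, β, and Maclaurin's inequality handles the
symmetric functions. The increment is at most ϑ/(2N) · (k+1) √β^(n-2-k) √κ^k, which is one term of
f_n. -/

/-! ### The polynomial f_n and its closed form. -/

theorem f_add_two (m : ℕ) (x₁ x₂ : ℝ) :
    f (m + 2) x₁ x₂ = ∑ k ∈ range (m + 1), ((k : ℝ) + 1) * x₁ ^ (m - k) * x₂ ^ k := by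
  unfold f
  rw [← Finset.Ico_succ_right_eq_Icc, Finset.sum_Ico_eq_sum_range]
  refine Finset.sum_congr (by simp) fun k _ => ?_
  have h1 : m + 2 - (2 + k) = m - k := by omega
  have h2 : 2 + k - 2 = k := by omega
  rw [h1, h2]
  push_cast
  ring

theorem f_mul_sq_sub (m : ℕ) (x₁ x₂ : ℝ) :
    f (m + 2) x₁ x₂ * (x₂ - x₁) ^ 2 =
      ((m : ℝ) + 1) * x₂ ^ (m + 2) - ((m : ℝ) + 2) * x₁ * x₂ ^ (m + 1) + x₁ ^ (m + 2) := by
  induction m with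
  | zero => rw [f_add_two]; simp; ring
  | succ m ih =>
    -- Horner-type recursion: all terms but the last carry a factor x₁.
    have step : f (m + 1 + 2) x₁ x₂ = x₁ * f (m + 2) x₁ x₂ + ((m : ℝ) + 2) * x₂ ^ (m + 1) := by
      rw [f_add_two, f_add_two, Finset.sum_range_succ, Finset.mul_sum]
      congr 1
      · refine Finset.sum_congr rfl fun k hk => ?_
        have h1 : m + 1 - k = (m - k) + 1 := by
          have := Finset.mem_range.1 hk
          omega
        rw [h1]
        ring
      · push_cast
        rw [Nat.sub_self]
        ring
    rw [step, add_mul, mul_assoc, ih]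
    push_cast
    ring

theorem f_eq_div {n : ℕ} (hn : 2 ≤ n) {x₁ x₂ : ℝ} (h : x₁ ≠ x₂) :
    f n x₁ x₂ = (((n : ℝ) - 1) * x₂ ^ n - (n : ℝ) * x₁ * x₂ ^ (n - 1) + x₁ ^ n) / (x₂ - x₁) ^ 2 := by
  obtain ⟨m, rfl⟩ := Nat.exists_eq_add_of_le' hn
  rw [eq_div_iff (pow_ne_zero 2 (sub_ne_zero.2 h.symm)), f_mul_sq_sub]
  push_cast
  ring

/-! ### Double counting of sets of columns with marked elements. -/

section Counting

variable {γ M : Type*} [DecidableEq γ] [AddCommMonoid M]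

theorem sum_powersetCard_succ_erase (s : Finset γ) (k : ℕ) (G : γ → Finset γ → M) :
    ∑ K ∈ powersetCard (k + 1) s, ∑ r ∈ K, G r (K.erase r) =
      ∑ L ∈ powersetCard k s, ∑ r ∈ s \ L, G r L := by
  rw [Finset.sum_sigma', Finset.sum_sigma']
  refine Finset.sum_bij' (fun x _ => ⟨x.1.erase x.2, x.2⟩) (fun x _ => ⟨insert x.2 x.1, x.2⟩)
    ?_ ?_ ?_ ?_ ?_
  · rintro ⟨K, r⟩ h
    simp only [mem_sigma, mem_powersetCard, mem_sdiff] at h ⊢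
    obtain ⟨⟨h1, h2⟩, h3⟩ := h
    exact ⟨⟨(erase_subset _ _).trans h1, by rw [card_erase_of_mem h3, h2]; rfl⟩, h1 h3, by simp⟩
  · rintro ⟨K, r⟩ h
    simp only [mem_sigma, mem_powersetCard, mem_sdiff] at h ⊢
    obtain ⟨⟨h1, h2⟩, h3, h4⟩ := h
    exact ⟨⟨insert_subset h3 h1, by rw [card_insert_of_notMem h4, h2]⟩, by simp⟩
  · rintro ⟨K, r⟩ h
    simp only [mem_sigma] at h
    simp [insert_erase h.2]
  · rintro ⟨K, r⟩ h
    simp only [mem_sigma, mem_sdiff] at h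
    simp [erase_insert h.2.2]
  · rintro ⟨K, r⟩ h
    rfl

theorem sum_powersetCard_offDiag [Fintype γ] (k : ℕ) (G : γ × γ → Finset γ → M) :
    ∑ K ∈ powersetCard (k + 2) univ, ∑ p ∈ K.offDiag, G p ((K.erase p.1).erase p.2) =
      ∑ p ∈ (univ : Finset γ).offDiag, ∑ L ∈ powersetCard k (univ \ {p.1, p.2}), G p L := by
  rw [Finset.sum_sigma', Finset.sum_sigma']
  refine Finset.sum_bij' (fun x _ => ⟨x.2, (x.1.erase x.2.1).erase x.2.2⟩)
    (fun x _ => ⟨insert x.1.1 (insert x.1.2 x.2), x.1⟩) ?_ ?_ ?_ ?_ ?_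
  · rintro ⟨K, r, t⟩ h
    simp only [mem_sigma, mem_powersetCard, mem_offDiag, mem_univ, true_and, subset_univ] at h ⊢
    obtain ⟨h2, h3, h4, h5⟩ := h
    refine ⟨h5, fun x hx => ?_, ?_⟩
    · simp only [mem_erase] at hx
      simp [hx.1, hx.2.1]
    · rw [card_erase_of_mem (mem_erase.2 ⟨h5.symm, h4⟩), card_erase_of_mem h3, h2]
      rfl
  · rintro ⟨⟨r, t⟩, L⟩ h
    simp only [mem_sigma, mem_powersetCard, mem_offDiag, mem_univ, true_and, subset_univ] at h ⊢
    obtain ⟨h2, h3, h4⟩ := h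
    have hr : r ∉ L := fun hx => by simpa using h3 hx
    have ht : t ∉ L := fun hx => by simpa using h3 hx
    refine ⟨?_, by simp, by simp, h2⟩
    rw [card_insert_of_notMem (by simp [h2, hr]), card_insert_of_notMem ht, h4]
  · rintro ⟨K, r, t⟩ h
    simp only [mem_sigma, mem_offDiag] at h
    obtain ⟨-, h3, h4, h5⟩ := h
    simp only [Sigma.mk.injEq, heq_eq_eq, and_true]
    rw [insert_erase (mem_erase.2 ⟨h5.symm, h4⟩), insert_erase h3]
  · rintro ⟨⟨r, t⟩, L⟩ h
    simp only [mem_sigma, mem_powersetCard, mem_offDiag, mem_univ, true_and] at h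
    obtain ⟨h2, h3, h4⟩ := h
    have hr : r ∉ L := fun hx => by simpa using h3 hx
    have ht : t ∉ L := fun hx => by simpa using h3 hx
    simp only [Sigma.mk.injEq, heq_eq_eq, true_and]
    rw [erase_insert (by simp [h2, hr]), erase_insert ht]
  · rintro ⟨K, r, t⟩ h
    rfl

theorem sum_sum_erase_eq_sum_offDiag (K : Finset γ) (G : γ × γ → M) :
    ∑ r ∈ K, ∑ t ∈ K.erase r, G (r, t) = ∑ p ∈ K.offDiag, G p := by
  rw [Finset.sum_sigma']
  refine Finset.sum_bij' (fun x _ => (x.1, x.2)) (fun x _ => ⟨x.1, x.2⟩) ?_ ?_ ?_ ?_ ?_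
  · rintro ⟨r, t⟩ h
    simp only [mem_sigma, mem_erase, mem_offDiag] at h ⊢
    exact ⟨h.1, h.2.2, h.2.1.symm⟩
  · rintro ⟨r, t⟩ h
    simp only [mem_sigma, mem_erase, mem_offDiag] at h ⊢
    exact ⟨h.1, h.2.2.symm, h.2.1⟩
  all_goals intros; rfl

end Counting

/-! ### Sums over permutations and the transposition identity. -/

section Perm

theorem exists_perm_comp_eq {ι γ : Type*} [Finite ι] (j j' : γ ↪ ι) :
    ∃ τ : Perm ι, ∀ x, τ (j x) = j' x := by
  classical
  refine ⟨((Equiv.ofInjective j j.injective).symm.trans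
    (Equiv.ofInjective j' j'.injective)).extendSubtype, fun x => ?_⟩
  rw [Equiv.extendSubtype_apply_of_mem _ _ ⟨x, rfl⟩]
  have : (⟨j x, ⟨x, rfl⟩⟩ : Set.range j) = Equiv.ofInjective j j.injective x := rfl
  rw [this, Equiv.trans_apply, Equiv.symm_apply_apply]
  rfl

variable {ι γ : Type*} [Fintype ι] [DecidableEq ι]

/-- Left multiplication permutes the fibres of σ ↦ σ ∘ c transitively, so they have equal size;
together they make up all permutations. -/
theorem card_perm_extending [DecidableEq γ] [Fintype γ] (c j : γ ↪ ι) :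
    #{σ : Perm ι | ∀ x, σ (c x) = j x} = (Fintype.card ι - Fintype.card γ).factorial := by
  have key : ∀ j' : γ ↪ ι,
      #{σ : Perm ι | ∀ x, σ (c x) = j' x} = #{σ : Perm ι | ∀ x, σ (c x) = j x} := by
    intro j'
    obtain ⟨τ, hτ⟩ := exists_perm_comp_eq j' j
    refine Finset.card_equiv (Equiv.mulLeft τ) fun σ => ?_
    simp [← hτ]
  have h1 : ∑ j' : γ ↪ ι, #{σ : Perm ι | ∀ x, σ (c x) = j' x} = (Fintype.card ι).factorial := by
    rw [← Fintype.card_perm, ← Finset.card_univ,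
      Finset.card_eq_sum_card_fiberwise (f := fun σ : Perm ι => c.trans σ.toEmbedding)
        (t := univ) (fun _ _ => by simp)]
    refine Finset.sum_congr rfl fun j' _ => ?_
    congr 1
    ext σ
    simp [DFunLike.ext_iff]
  have hle : Fintype.card γ ≤ Fintype.card ι := Fintype.card_le_of_embedding c
  rw [Finset.sum_congr rfl fun j' _ => key j', Finset.sum_const, Finset.card_univ,
    Fintype.card_embedding_eq, smul_eq_mul, ← Nat.factorial_mul_descFactorial hle, mul_comm] at h1
  exact Nat.eq_of_mul_eq_mul_right (Nat.descFactorial_pos.2 hle) h1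

theorem sum_perm_prod_eq [DecidableEq γ] [Fintype γ] {R : Type*} [CommRing R] (c : γ ↪ ι)
    (Z : ι → γ → R) :
    ∑ σ : Perm ι, ∏ t, Z (σ (c t)) t =
      ((Fintype.card ι - Fintype.card γ).factorial : R) * ∑ j : γ ↪ ι, ∏ t, Z (j t) t := by
  rw [← Finset.sum_fiberwise_of_maps_to (s := univ) (t := univ)
    (g := fun σ : Perm ι => c.trans σ.toEmbedding) (fun _ _ => mem_univ _), Finset.mul_sum]
  refine Finset.sum_congr rfl fun j _ => ?_
  have : ∀ σ ∈ ({σ : Perm ι | c.trans σ.toEmbedding = j} : Finset _),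
      ∏ t, Z (σ (c t)) t = ∏ t, Z (j t) t := by
    intro σ hσ
    simp only [mem_filter, mem_univ, true_and] at hσ
    simp [← hσ]
  rw [Finset.sum_congr rfl this, Finset.sum_const, nsmul_eq_mul, ← card_perm_extending c j]
  congr 3
  ext σ
  simp [DFunLike.ext_iff]

variable [DecidableEq γ] {R : Type*} [CommRing R]

/-- Right multiplication by the transposition of `c r` and `s` moves no row used by the other
columns, so a free index `s` is as good as `c r`. -/
theorem sum_perm_prod_erase_mul_of_notMem (c : γ ↪ ι) (Z : ι → γ → R) {K : Finset γ} {r : γ}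
    (hr : r ∈ K) {s : ι} (hs : s ∉ (K.erase r).map c) :
    ∑ σ : Perm ι, (∏ t ∈ K.erase r, Z (σ (c t)) t) * Z (σ s) r =
      ∑ σ : Perm ι, ∏ t ∈ K, Z (σ (c t)) t := by
  rw [← Equiv.sum_comp (Equiv.mulRight (swap (c r) s))]
  refine Finset.sum_congr rfl fun σ _ => ?_
  rw [← Finset.prod_erase_mul _ _ hr]
  simp only [coe_mulRight, Perm.coe_mul, Function.comp_apply, swap_apply_right]
  congr 1
  refine Finset.prod_congr rfl fun t ht => ?_
  rw [swap_apply_of_ne_of_ne]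
  · exact fun h => (mem_erase.1 ht).1 (c.injective h)
  · rintro rfl
    exact hs (mem_map_of_mem c ht)

/-- Averaging the summand with its image under the transposition of `c r` and `c s` factors the
difference; the 2 stands for this average, since R need not allow halving. -/
theorem two_mul_sum_perm_sub (c : γ ↪ ι) (Z : ι → γ → R) {K : Finset γ} {r s : γ}
    (hr : r ∈ K) (hs : s ∈ K.erase r) :
    2 * (∑ σ : Perm ι, ∏ t ∈ K, Z (σ (c t)) t -
        ∑ σ : Perm ι, (∏ t ∈ K.erase r, Z (σ (c t)) t) * Z (σ (c s)) r) =
      -∑ σ : Perm ι, (∏ t ∈ (K.erase r).erase s, Z (σ (c t)) t) *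
        ((Z (σ (c r)) r - Z (σ (c s)) r) * (Z (σ (c r)) s - Z (σ (c s)) s)) := by
  set F : Perm ι → R := fun σ =>
    ∏ t ∈ K, Z (σ (c t)) t - (∏ t ∈ K.erase r, Z (σ (c t)) t) * Z (σ (c s)) r with hF
  have hsw : ∑ σ : Perm ι, F σ = ∑ σ : Perm ι, F (σ * swap (c r) (c s)) :=
    (Equiv.sum_comp (Equiv.mulRight (swap (c r) (c s))) F).symm
  have hC : ∀ σ : Perm ι, ∏ t ∈ (K.erase r).erase s, Z ((σ * swap (c r) (c s)) (c t)) t =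
      ∏ t ∈ (K.erase r).erase s, Z (σ (c t)) t := by
    intro σ
    refine Finset.prod_congr rfl fun t ht => ?_
    simp only [mem_erase] at ht
    rw [Perm.mul_apply, swap_apply_of_ne_of_ne (fun h => ht.2.1 (c.injective h))
      (fun h => ht.1 (c.injective h))]
  rw [← Finset.sum_sub_distrib, two_mul]
  change ∑ σ, F σ + ∑ σ, F σ = _
  nth_rewrite 2 [hsw]
  rw [← Finset.sum_add_distrib, ← Finset.sum_neg_distrib]
  refine Finset.sum_congr rfl fun σ _ => ?_
  simp only [hF]
  rw [← Finset.prod_erase_mul _ _ hr, ← Finset.prod_erase_mul _ _ hs,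
    ← Finset.prod_erase_mul _ _ hr, ← Finset.prod_erase_mul _ _ hs, hC]
  simp only [Perm.mul_apply, swap_apply_left, swap_apply_right]
  ring

/-- For each σ the column sum is the sum of `Z (σ s) r` over all rows `s`. The free `s` each
reproduce the full product; only those occupied by another column of `K` leave a defect. -/
theorem two_mul_card_mul_sum_perm_sub (c : γ ↪ ι) (Z : ι → γ → R) {K : Finset γ} {r : γ}
    (hr : r ∈ K) :
    2 * ((Fintype.card ι : R) * ∑ σ : Perm ι, ∏ t ∈ K, Z (σ (c t)) t -
        (∑ j, Z j r) * ∑ σ : Perm ι, ∏ t ∈ K.erase r, Z (σ (c t)) t) =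
      -∑ s ∈ K.erase r, ∑ σ : Perm ι, (∏ t ∈ (K.erase r).erase s, Z (σ (c t)) t) *
        ((Z (σ (c r)) r - Z (σ (c s)) r) * (Z (σ (c r)) s - Z (σ (c s)) s)) := by
  have h1 : (∑ j, Z j r) * ∑ σ : Perm ι, ∏ t ∈ K.erase r, Z (σ (c t)) t =
      ∑ s : ι, ∑ σ : Perm ι, (∏ t ∈ K.erase r, Z (σ (c t)) t) * Z (σ s) r := by
    rw [Finset.sum_comm, mul_comm, Finset.sum_mul]
    refine Finset.sum_congr rfl fun σ _ => ?_
    rw [← Finset.mul_sum, Equiv.sum_comp σ (fun j => Z j r)]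
  rw [h1, ← nsmul_eq_mul, ← Finset.card_univ, ← Finset.sum_const, ← Finset.sum_sub_distrib,
    ← Finset.sum_subset (subset_univ ((K.erase r).map c)), Finset.sum_map, Finset.mul_sum,
    ← Finset.sum_neg_distrib]
  · exact Finset.sum_congr rfl fun s hs => two_mul_sum_perm_sub c Z hr hs
  · intro s _ hs
    rw [sum_perm_prod_erase_mul_of_notMem c Z hr hs, sub_self]

end Perm

/-! ### Maclaurin's inequality from the transposition identity. -/

section Maclaurin

variable {ι : Type*} [Fintype ι] [DecidableEq ι]

/-- When all columns are equal, the product of the two row differences is a square, so the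
transposition identity says that adding a column multiplies the sum by at most the mean. -/
theorem sum_perm_prod_le (b : ι → ℝ) (hb : ∀ i, 0 ≤ b i) (K : Finset ι) :
    ∑ σ : Perm ι, ∏ t ∈ K, b (σ t) ≤
      (Fintype.card ι).factorial * ((∑ i, b i) / Fintype.card ι) ^ #K := by
  induction K using Finset.induction_on with
  | empty => simp [Fintype.card_perm]
  | insert r K hr ih =>
    have hpos : (0 : ℝ) < Fintype.card ι := by
      exact_mod_cast Fintype.card_pos_iff.2 ⟨r⟩
    have h := two_mul_card_mul_sum_perm_sub (Function.Embedding.refl ι) (fun j _ => b j)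
      (mem_insert_self r K)
    simp only [Function.Embedding.refl_apply, erase_insert hr] at h
    have hnn : 0 ≤ ∑ s ∈ K, ∑ σ : Perm ι, (∏ t ∈ K.erase s, b (σ t)) *
        ((b (σ r) - b (σ s)) * (b (σ r) - b (σ s))) :=
      Finset.sum_nonneg fun s _ => Finset.sum_nonneg fun σ _ =>
        mul_nonneg (Finset.prod_nonneg fun _ _ => hb _) (mul_self_nonneg _)
    have h2 : ∑ σ : Perm ι, ∏ t ∈ insert r K, b (σ t) ≤
        (∑ i, b i) / Fintype.card ι * ∑ σ : Perm ι, ∏ t ∈ K, b (σ t) := by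
      rw [div_mul_eq_mul_div, le_div_iff₀ hpos]
      linarith
    refine h2.trans ((mul_le_mul_of_nonneg_left ih
      (div_nonneg (Finset.sum_nonneg fun i _ => hb i) hpos.le)).trans_eq ?_)
    rw [card_insert_of_notMem hr]
    ring

theorem sum_powersetCard_univ_prod_le (b : ι → ℝ) (hb : ∀ i, 0 ≤ b i) (k : ℕ) :
    ∑ K ∈ powersetCard k univ, ∏ t ∈ K, b t ≤
      (Fintype.card ι).choose k * ((∑ i, b i) / Fintype.card ι) ^ k := by
  have h1 : ∑ K ∈ powersetCard k (univ : Finset ι), ∑ σ : Perm ι, ∏ t ∈ K, b (σ t) =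
      (Fintype.card ι).factorial * ∑ K ∈ powersetCard k univ, ∏ t ∈ K, b t := by
    have h : ∀ σ : Perm ι, ∑ K ∈ powersetCard k (univ : Finset ι), ∏ t ∈ K, b (σ t) =
        ∑ K ∈ powersetCard k univ, ∏ t ∈ K, b t := by
      intro σ
      conv_rhs => rw [← Finset.map_univ_equiv σ, powersetCard_map, Finset.sum_map]
      simp [mapEmbedding_apply]
    rw [Finset.sum_comm, Finset.sum_congr rfl fun σ _ => h σ, Finset.sum_const,
      Finset.card_univ, Fintype.card_perm, nsmul_eq_mul]
  have h2 : ∑ K ∈ powersetCard k (univ : Finset ι), ∑ σ : Perm ι, ∏ t ∈ K, b (σ t) ≤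
      ∑ K ∈ powersetCard k (univ : Finset ι),
        (Fintype.card ι).factorial * ((∑ i, b i) / Fintype.card ι) ^ k := by
    refine Finset.sum_le_sum fun K hK => ?_
    have := sum_perm_prod_le b hb K
    rwa [(mem_powersetCard.1 hK).2] at this
  rw [h1, Finset.sum_const, card_powersetCard, Finset.card_univ, nsmul_eq_mul,
    mul_left_comm] at h2
  exact le_of_mul_le_mul_left h2 (by positivity)

/-- Maclaurin's inequality between an elementary symmetric mean and the arithmetic mean. -/
theorem sum_powersetCard_prod_le {γ : Type*} [DecidableEq γ] (s : Finset γ) (b : γ → ℝ)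
    (hb : ∀ i, 0 ≤ b i) (k : ℕ) :
    ∑ K ∈ powersetCard k s, ∏ t ∈ K, b t ≤ (#s).choose k * ((∑ i ∈ s, b i) / #s) ^ k := by
  have h := sum_powersetCard_univ_prod_le (fun i : s => b i) (fun i => hb i) k
  have h1 : ∑ K ∈ powersetCard k s, ∏ t ∈ K, b t =
      ∑ K ∈ powersetCard k (univ : Finset s), ∏ t ∈ K, b t := by
    conv_lhs => rw [← Finset.attach_map_val (s := s), powersetCard_map, Finset.sum_map]
    simp [mapEmbedding_apply]
  rw [h1, ← Finset.sum_coe_sort s b, ← Fintype.card_coe s]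
  exact h

end Maclaurin

/-! ### Averages of products bounded by quadratic means of columns. -/

section Smoothing

/-- For two factors this is Cauchy–Schwarz in the plane; with three it fails, for example for x = 1,
y = 0. -/
theorem prod_add_prod_le_of_card_le_two {γ : Type*} [DecidableEq γ] {R : Finset γ} (hR : #R ≤ 2)
    (x y : γ → ℝ) :
    ∏ r ∈ R, x r + ∏ r ∈ R, y r ≤ 2 * ∏ r ∈ R, √((x r ^ 2 + y r ^ 2) / 2) := by
  interval_cases h : #R
  · rw [Finset.card_eq_zero.1 h]
    norm_num
  · obtain ⟨a, rfl⟩ := Finset.card_eq_one.1 h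
    simp only [Finset.prod_singleton]
    have : (x a + y a) / 2 ≤ √((x a ^ 2 + y a ^ 2) / 2) := by
      apply Real.le_sqrt_of_sq_le
      nlinarith [sq_nonneg (x a - y a)]
    linarith
  · obtain ⟨a, b, hab, rfl⟩ := Finset.card_eq_two.1 h
    rw [Finset.prod_pair hab, Finset.prod_pair hab, Finset.prod_pair hab,
      ← Real.sqrt_mul (by positivity)]
    have : (x a * x b + y a * y b) / 2 ≤
        √((x a ^ 2 + y a ^ 2) / 2 * ((x b ^ 2 + y b ^ 2) / 2)) := by
      apply Real.le_sqrt_of_sq_le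
      nlinarith [sq_nonneg (x a * y b - y a * x b)]
    linarith

variable {ι γ : Type*} [DecidableEq ι]

/-- The matrix obtained by replacing the rows `u` and `v` by their entrywise quadratic mean. -/
noncomputable def smoothRows (u v : ι) (A : ι → γ → ℝ) (j : ι) (t : γ) : ℝ :=
  if j = u ∨ j = v then √((A u t ^ 2 + A v t ^ 2) / 2) else A j t

theorem smoothRows_nonneg {u v : ι} {A : ι → γ → ℝ} (hA : ∀ j t, 0 ≤ A j t) (j : ι) (t : γ) :
    0 ≤ smoothRows u v A j t := by
  unfold smoothRows
  split_ifs
  · positivity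
  · exact hA j t

/-- As σ ∘ c is injective, at most two columns land in the rows `u`, `v`; the others contribute a
common factor. -/
theorem prod_add_prod_swap_le [DecidableEq γ] (c : γ ↪ ι) {A : ι → γ → ℝ} (hA : ∀ j t, 0 ≤ A j t)
    (L : Finset γ) {u v : ι} (σ : Perm ι) :
    ∏ t ∈ L, A (σ (c t)) t + ∏ t ∈ L, A ((swap u v * σ) (c t)) t ≤
      2 * ∏ t ∈ L, smoothRows u v A (σ (c t)) t := by
  set p : γ → Prop := fun t => σ (c t) = u ∨ σ (c t) = v
  have hcard : #(L.filter p) ≤ 2 := by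
    have : (L.filter p).map (c.trans σ.toEmbedding) ⊆ {u, v} := by
      intro j
      simp only [mem_map, mem_filter, mem_insert, mem_singleton]
      rintro ⟨t, ⟨-, ht⟩, rfl⟩
      exact ht
    calc #(L.filter p) = #((L.filter p).map (c.trans σ.toEmbedding)) := (card_map _).symm
      _ ≤ #{u, v} := card_le_card this
      _ ≤ 2 := card_le_two
  rw [← Finset.prod_filter_mul_prod_filter_not L p, ← Finset.prod_filter_mul_prod_filter_not L p,
    ← Finset.prod_filter_mul_prod_filter_not L p (fun t => smoothRows u v A (σ (c t)) t)]
  have h1 : ∏ t ∈ L with ¬p t, A ((swap u v * σ) (c t)) t = ∏ t ∈ L with ¬p t, A (σ (c t)) t := by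
    refine Finset.prod_congr rfl fun t ht => ?_
    have := (mem_filter.1 ht).2
    simp only [p, not_or] at this
    rw [Perm.mul_apply, swap_apply_of_ne_of_ne this.1 this.2]
  have h2 : ∏ t ∈ L with ¬p t, smoothRows u v A (σ (c t)) t =
      ∏ t ∈ L with ¬p t, A (σ (c t)) t := by
    refine Finset.prod_congr rfl fun t ht => ?_
    exact if_neg (mem_filter.1 ht).2
  have h3 : ∏ t ∈ L with p t, smoothRows u v A (σ (c t)) t =
      ∏ t ∈ L with p t, √((A (σ (c t)) t ^ 2 + A ((swap u v * σ) (c t)) t ^ 2) / 2) := by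
    refine Finset.prod_congr rfl fun t ht => ?_
    have ht := (mem_filter.1 ht).2
    rw [smoothRows, if_pos ht]
    rcases ht with h | h
    · rw [Perm.mul_apply, h, swap_apply_left]
    · rw [Perm.mul_apply, h, swap_apply_right, add_comm]
  rw [h1, h2, h3, ← add_mul, ← mul_assoc]
  exact mul_le_mul_of_nonneg_right (prod_add_prod_le_of_card_le_two hcard _ _)
    (Finset.prod_nonneg fun _ _ => hA _ _)

theorem sum_prod_le_sum_prod_smoothRows [DecidableEq γ] (c : γ ↪ ι) {A : ι → γ → ℝ}
    (hA : ∀ j t, 0 ≤ A j t) (L : Finset γ) {u v : ι} {Ω : Finset (Perm ι)}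
    (hΩ : ∀ σ ∈ Ω, swap u v * σ ∈ Ω) :
    ∑ σ ∈ Ω, ∏ t ∈ L, A (σ (c t)) t ≤ ∑ σ ∈ Ω, ∏ t ∈ L, smoothRows u v A (σ (c t)) t := by
  have h : ∑ σ ∈ Ω, ∏ t ∈ L, A (σ (c t)) t = ∑ σ ∈ Ω, ∏ t ∈ L, A ((swap u v * σ) (c t)) t := by
    refine Finset.sum_bij' (fun σ _ => swap u v * σ) (fun σ _ => swap u v * σ) hΩ hΩ ?_ ?_ ?_ <;>
      intro σ _ <;> simp [← mul_assoc, -Perm.coe_mul]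
  have h2 := Finset.sum_le_sum fun σ (_ : σ ∈ Ω) => prod_add_prod_swap_le c hA L (u := u) (v := v) σ
  rw [Finset.sum_add_distrib, ← h, ← Finset.mul_sum] at h2
  linarith

theorem sum_comp_smoothRows {S : Finset ι} {u v : ι} (hu : u ∈ S) (hv : v ∈ S) (huv : u ≠ v)
    (A : ι → γ → ℝ) (t : γ) (φ : ℝ → ℝ) :
    ∑ j ∈ S, φ (smoothRows u v A j t) = ∑ j ∈ S, φ (A j t) +
      (2 * φ (√((A u t ^ 2 + A v t ^ 2) / 2)) - (φ (A u t) + φ (A v t))) := by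
  have hsub : ({u, v} : Finset ι) ⊆ S := by
    simp [insert_subset_iff, hu, hv]
  rw [← Finset.sum_sdiff hsub, ← Finset.sum_sdiff hsub (f := fun j => φ (A j t)),
    Finset.sum_pair huv, Finset.sum_pair huv]
  have h : ∑ j ∈ S \ {u, v}, φ (smoothRows u v A j t) = ∑ j ∈ S \ {u, v}, φ (A j t) := by
    refine Finset.sum_congr rfl fun j hj => ?_
    have : ¬(j = u ∨ j = v) := by simpa using (mem_sdiff.1 hj).2
    rw [smoothRows, if_neg this]
  rw [h]
  simp only [smoothRows, true_or, or_true, if_true]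
  ring

/-- A permanent inequality of Carlen, Lieb and Loss type: averages of products of entries along
permutations are bounded by products of quadratic means of the columns. -/
theorem sum_prod_le_card_mul_prod_sqrt [Fintype ι] [Fintype γ] [DecidableEq γ] (c : γ ↪ ι)
    (S : Finset ι) (L : Finset γ) (Ω : Finset (Perm ι))
    (hΩ : ∀ σ ∈ Ω, ∀ u ∈ S, ∀ v ∈ S, swap u v * σ ∈ Ω) (hS : ∀ σ ∈ Ω, ∀ t ∈ L, σ (c t) ∈ S)
    (a : ι → γ → ℝ) (ha : ∀ j t, 0 ≤ a j t) :
    ∑ σ ∈ Ω, ∏ t ∈ L, a (σ (c t)) t ≤ #Ω * ∏ t ∈ L, √((∑ j ∈ S, a j t ^ 2) / #S) := by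
  set F : (ι → γ → ℝ) → ℝ := fun A => ∑ σ ∈ Ω, ∏ t ∈ L, A (σ (c t)) t with hF
  set G : (ι → γ → ℝ) → ℝ := fun A => ∑ t, ∑ j ∈ S, A j t with hG
  have hFc : Continuous F := by fun_prop
  have hGc : Continuous G := by fun_prop
  set D : γ → ℝ := fun t => ∑ j ∈ S, a j t ^ 2 with hD
  -- The column square sums over `S` are prescribed. The upper bound makes `X` compact: it also
  -- controls rows outside `S`, and √D is a bound that smoothed entries respect.
  set X : Set (ι → γ → ℝ) := {A | (∀ j t, 0 ≤ A j t) ∧ (∀ t, ∑ j ∈ S, A j t ^ 2 = D t) ∧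
    ∀ j t, A j t ≤ max (a j t) (√(D t))} with hX
  have hXc : IsCompact X := by
    have hK : IsCompact (Set.Icc (0 : ι → γ → ℝ) fun j t => max (a j t) (√(D t))) := isCompact_Icc
    refine hK.of_isClosed_subset ?_ fun A hA => ⟨fun j t => hA.1 j t, fun j t => hA.2.2 j t⟩
    simp only [hX, Set.ofPred_and, Set.ofPred_forall]
    refine IsClosed.inter ?_ (IsClosed.inter ?_ ?_)
    · exact isClosed_iInter fun j => isClosed_iInter fun t =>
        isClosed_le continuous_const (by fun_prop)
    · exact isClosed_iInter fun t => isClosed_eq (by fun_prop) continuous_const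
    · exact isClosed_iInter fun j => isClosed_iInter fun t =>
        isClosed_le (by fun_prop) continuous_const
  have haX : a ∈ X := ⟨ha, fun _ => rfl, fun _ _ => le_max_left _ _⟩
  obtain ⟨A₀, hA₀, hmax₀⟩ := hXc.exists_isMaxOn ⟨a, haX⟩ hFc.continuousOn
  -- Among the maximizers of `F`, take one with the largest entry sum over `S`. Smoothing two
  -- different rows of `S` does not lower `F` and strictly raises that sum, so these rows must all
  -- agree.
  obtain ⟨A, ⟨hA, hFA⟩, hmax⟩ := (hXc.inter_right (isClosed_eq hFc
    (continuous_const (y := F A₀)))).exists_isMaxOn ⟨A₀, hA₀, rfl⟩ hGc.continuousOn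
  have hrow : ∀ u ∈ S, ∀ v ∈ S, ∀ t, A u t = A v t := by
    intro u hu v hv
    by_contra! hne
    obtain ⟨t₀, ht₀⟩ := hne
    have huv : u ≠ v := fun h => ht₀ (by rw [h])
    have hnn := smoothRows_nonneg (u := u) (v := v) hA.1
    have hsq : ∀ t, ∑ j ∈ S, smoothRows u v A j t ^ 2 = D t := by
      intro t
      rw [sum_comp_smoothRows hu hv huv A t (fun x => x ^ 2), Real.sq_sqrt (by positivity),
        hA.2.1 t]
      ring
    have hX' : smoothRows u v A ∈ X := by
      refine ⟨hnn, hsq, fun j t => ?_⟩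
      by_cases hj : j = u ∨ j = v
      · refine le_max_of_le_right (Real.le_sqrt_of_sq_le ?_)
        rw [← hsq t]
        have hjS : j ∈ S := by rcases hj with rfl | rfl <;> assumption
        exact Finset.single_le_sum (f := fun j => smoothRows u v A j t ^ 2)
          (fun _ _ => sq_nonneg _) hjS
      · rw [smoothRows, if_neg hj]
        exact hA.2.2 j t
    have hFle : F A ≤ F (smoothRows u v A) :=
      sum_prod_le_sum_prod_smoothRows c hA.1 L fun σ hσ => hΩ σ hσ u hu v hv
    have hFeq : F (smoothRows u v A) = F A₀ :=
      le_antisymm (hmax₀ hX') (hFA ▸ hFle)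
    have hGle : G (smoothRows u v A) ≤ G A := hmax ⟨hX', hFeq⟩
    refine absurd hGle (not_le.2 ?_)
    have hstep : ∀ t, ∑ j ∈ S, smoothRows u v A j t = ∑ j ∈ S, A j t +
        (2 * √((A u t ^ 2 + A v t ^ 2) / 2) - (A u t + A v t)) := fun t =>
      sum_comp_smoothRows hu hv huv A t (fun x => x)
    refine Finset.sum_lt_sum (fun t _ => ?_) ⟨t₀, mem_univ _, ?_⟩
    · rw [hstep t]
      have : (A u t + A v t) / 2 ≤ √((A u t ^ 2 + A v t ^ 2) / 2) := by
        apply Real.le_sqrt_of_sq_le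
        nlinarith [sq_nonneg (A u t - A v t)]
      linarith
    · rw [hstep t₀]
      have : (A u t₀ + A v t₀) / 2 < √((A u t₀ ^ 2 + A v t₀ ^ 2) / 2) := by
        apply Real.lt_sqrt_of_sq_lt
        have := sq_pos_of_ne_zero (sub_ne_zero.2 ht₀)
        nlinarith
      linarith
  have hval : ∀ j ∈ S, ∀ t, A j t = √(D t / #S) := by
    intro j hj t
    have hpos : (0 : ℝ) < #S := by exact_mod_cast Finset.card_pos.2 ⟨j, hj⟩
    have : D t = #S * A j t ^ 2 := by
      rw [← hA.2.1 t, Finset.sum_congr rfl fun i hi => by rw [hrow i hi j hj t], Finset.sum_const,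
        nsmul_eq_mul]
    rw [this, mul_div_cancel_left₀ _ hpos.ne', Real.sqrt_sq (hA.1 j t)]
  calc F a ≤ F A₀ := hmax₀ haX
    _ = F A := hFA.symm
    _ = ∑ σ ∈ Ω, ∏ t ∈ L, √(D t / #S) :=
      Finset.sum_congr rfl fun σ hσ => Finset.prod_congr rfl fun t ht => hval _ (hS σ hσ t ht) t
    _ = _ := by rw [Finset.sum_const, nsmul_eq_mul]

end Smoothing

/-! ### Interpolation between the product of means and the permanent. -/

section Telescoping

variable {ι γ : Type*} [Fintype ι] [DecidableEq ι] [DecidableEq γ]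

/-- The sum over all permutations of the products of the entries in the columns in `K`. -/
def permSum (c : γ ↪ ι) (Z : ι → γ → ℂ) (K : Finset γ) : ℂ :=
  ∑ σ : Perm ι, ∏ t ∈ K, Z (σ (c t)) t

/-- The sum over all permutations of the products of the entries in the columns in `L`, weighted
with the row differences in the columns `p.1` and `p.2`. -/
def diffSum (c : γ ↪ ι) (Z : ι → γ → ℂ) (p : γ × γ) (L : Finset γ) : ℂ :=
  ∑ σ : Perm ι, (∏ t ∈ L, Z (σ (c t)) t) *
    ((Z (σ (c p.1)) p.1 - Z (σ (c p.2)) p.1) * (Z (σ (c p.1)) p.2 - Z (σ (c p.2)) p.2))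

/-- The mean of the entries of a column. -/
noncomputable def mean (Z : ι → γ → ℂ) (t : γ) : ℂ := (∑ j, Z j t) / Fintype.card ι

theorem permSum_eq (c : γ ↪ ι) (Z : ι → γ → ℂ) {K : Finset γ} {r : γ} (hr : r ∈ K) :
    permSum c Z K = mean Z r * permSum c Z (K.erase r) -
      (∑ s ∈ K.erase r, diffSum c Z (r, s) ((K.erase r).erase s)) / (2 * Fintype.card ι) := by
  have hN : (Fintype.card ι : ℂ) ≠ 0 := by
    exact_mod_cast (Fintype.card_pos_iff.2 ⟨c r⟩).ne'
  have h := two_mul_card_mul_sum_perm_sub c Z hr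
  unfold mean
  change 2 * ((Fintype.card ι : ℂ) * permSum c Z K - (∑ j, Z j r) * permSum c Z (K.erase r)) =
    -∑ s ∈ K.erase r, diffSum c Z (r, s) ((K.erase r).erase s) at h
  field_simp
  linear_combination h

variable [Fintype γ]

/-- The average over all sets of `k` columns of the product of the normalized permanent of these
columns and the means of the other columns. -/
noncomputable def interpolant (c : γ ↪ ι) (Z : ι → γ → ℂ) (k : ℕ) : ℂ :=
  (∑ K ∈ powersetCard k univ, permSum c Z K * ∏ t ∈ Kᶜ, mean Z t) /
    ((Fintype.card ι).factorial * (Fintype.card γ).choose k)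

theorem interpolant_zero (c : γ ↪ ι) (Z : ι → γ → ℂ) : interpolant c Z 0 = ∏ t, mean Z t := by
  have : ((Fintype.card ι).factorial : ℂ) ≠ 0 := by exact_mod_cast Nat.factorial_ne_zero _
  simp [interpolant, permSum, Fintype.card_perm, this]

theorem interpolant_card (c : γ ↪ ι) (Z : ι → γ → ℂ) :
    interpolant c Z (Fintype.card γ) = permSum c Z univ / (Fintype.card ι).factorial := by
  rw [interpolant, ← Finset.card_univ (α := γ), powersetCard_self]
  simp

/-- Average the one-column exchange `permSum_eq` over all `r ∈ K`. The leading terms regroup into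
the previous interpolant, since each `k`-set arises by deletion from `card γ - k` larger sets. -/
theorem interpolant_succ (c : γ ↪ ι) (Z : ι → γ → ℂ) {k : ℕ} (hk : k + 1 ≤ Fintype.card γ) :
    interpolant c Z (k + 1) = interpolant c Z k -
      (∑ K ∈ powersetCard (k + 1) univ, ∑ p ∈ K.offDiag,
        diffSum c Z p ((K.erase p.1).erase p.2) * ∏ t ∈ Kᶜ, mean Z t) /
      (2 * Fintype.card ι * (Fintype.card ι).factorial *
        ((k + 1) * (Fintype.card γ).choose (k + 1))) := by
  have hN : (Fintype.card ι : ℂ) ≠ 0 := by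
    have := Fintype.card_le_of_embedding c
    exact_mod_cast (show Fintype.card ι ≠ 0 by omega)
  have hfac : ((Fintype.card ι).factorial : ℂ) ≠ 0 := by exact_mod_cast Nat.factorial_ne_zero _
  have hc1 : ((Fintype.card γ).choose (k + 1) : ℂ) ≠ 0 := by
    exact_mod_cast (Nat.choose_pos hk).ne'
  have hc0 : ((Fintype.card γ).choose k : ℂ) ≠ 0 := by
    exact_mod_cast (Nat.choose_pos (by omega : k ≤ Fintype.card γ)).ne'
  have hk1 : (k : ℂ) + 1 ≠ 0 := by exact_mod_cast Nat.succ_ne_zero k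
  have hch : ((Fintype.card γ).choose (k + 1) : ℂ) * (k + 1) =
      (Fintype.card γ).choose k * ((Fintype.card γ - k : ℕ) : ℂ) := by
    exact_mod_cast Nat.choose_succ_right_eq (Fintype.card γ) k
  set W : Finset γ → ℂ := fun K => ∏ t ∈ Kᶜ, mean Z t with hW
  set A := ∑ K ∈ powersetCard (k + 1) univ, permSum c Z K * W K with hA
  set B := ∑ K ∈ powersetCard k univ, permSum c Z K * W K with hB
  set D := ∑ K ∈ powersetCard (k + 1) univ, ∑ p ∈ K.offDiag,
    diffSum c Z p ((K.erase p.1).erase p.2) * W K with hD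
  have hWe : ∀ K : Finset γ, ∀ r ∈ K, mean Z r * W K = W (K.erase r) := by
    intro K r hr
    simp only [hW, compl_erase]
    rw [Finset.prod_insert (by simpa using hr)]
  have h1 : ((k : ℂ) + 1) * A = ((Fintype.card γ - k : ℕ) : ℂ) * B -
      D / (2 * Fintype.card ι) := by
    have e1 : ((k : ℂ) + 1) * A =
        ∑ K ∈ powersetCard (k + 1) univ, ∑ r ∈ K, permSum c Z K * W K := by
      rw [hA, Finset.mul_sum]
      refine Finset.sum_congr rfl fun K hK => ?_
      rw [Finset.sum_const, (mem_powersetCard.1 hK).2, nsmul_eq_mul]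
      push_cast
      ring
    have e2 : ∑ K ∈ powersetCard (k + 1) univ, ∑ r ∈ K, permSum c Z (K.erase r) * W (K.erase r) =
        ((Fintype.card γ - k : ℕ) : ℂ) * B := by
      rw [sum_powersetCard_succ_erase univ k fun _ L => permSum c Z L * W L, hB, Finset.mul_sum]
      refine Finset.sum_congr rfl fun K hK => ?_
      rw [Finset.sum_const, ← compl_eq_univ_sdiff, card_compl, (mem_powersetCard.1 hK).2,
        nsmul_eq_mul]
    have e3 : D = ∑ K ∈ powersetCard (k + 1) univ, ∑ r ∈ K, ∑ s ∈ K.erase r,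
        diffSum c Z (r, s) ((K.erase r).erase s) * W K := by
      refine Finset.sum_congr rfl fun K _ => ?_
      rw [← sum_sum_erase_eq_sum_offDiag]
    rw [e1, ← e2, e3, Finset.sum_div, ← Finset.sum_sub_distrib]
    refine Finset.sum_congr rfl fun K _ => ?_
    rw [Finset.sum_div, ← Finset.sum_sub_distrib]
    refine Finset.sum_congr rfl fun r hr => ?_
    rw [permSum_eq c Z hr, ← hWe K r hr, ← Finset.sum_mul]
    ring
  have h2 : A = (((Fintype.card γ - k : ℕ) : ℂ) * B - D / (2 * Fintype.card ι)) / (k + 1) := by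
    rw [← h1, mul_div_cancel_left₀ _ hk1]
  have h3 : ((Fintype.card γ - k : ℕ) : ℂ) =
      ((Fintype.card γ).choose (k + 1) : ℂ) * (k + 1) / (Fintype.card γ).choose k := by
    rw [hch, mul_div_cancel_left₀ _ hc0]
  change A / _ = B / _ - D / _
  rw [h2, h3]
  field_simp

/-- A single column contains no pair of distinct columns, so the first increment vanishes. -/
theorem interpolant_one (c : γ ↪ ι) (Z : ι → γ → ℂ) (h : 1 ≤ Fintype.card γ) :
    interpolant c Z 1 = ∏ t, mean Z t := by
  rw [interpolant_succ c Z (k := 0) h, interpolant_zero, Finset.sum_eq_zero]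
  · simp
  · intro K hK
    obtain ⟨a, rfl⟩ := Finset.card_eq_one.1 (mem_powersetCard.1 hK).2
    simp

theorem sum_offDiag_mul_prod_compl {R : Type*} [CommRing R] (k : ℕ) (G : γ × γ → Finset γ → R)
    (w : γ → R) :
    ∑ K ∈ powersetCard (k + 2) univ, ∑ p ∈ K.offDiag,
        G p ((K.erase p.1).erase p.2) * ∏ t ∈ Kᶜ, w t =
      ∑ p ∈ (univ : Finset γ).offDiag, ∑ L ∈ powersetCard k (univ \ {p.1, p.2}),
        G p L * ∏ t ∈ (univ \ {p.1, p.2}) \ L, w t := by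
  rw [← sum_powersetCard_offDiag k fun p L => G p L * ∏ t ∈ (univ \ {p.1, p.2}) \ L, w t]
  refine Finset.sum_congr rfl fun K _ => Finset.sum_congr rfl fun p hp => ?_
  congr 2
  ext t
  have hp := mem_offDiag.1 hp
  simp only [mem_compl, mem_sdiff, mem_univ, true_and, mem_insert, mem_singleton, mem_erase]
  constructor
  · intro h
    refine ⟨?_, by tauto⟩
    rintro (rfl | rfl)
    · exact h hp.1
    · exact h hp.2.1
  · tauto

end Telescoping

/-! ### Bounding the increments by ϑ, κ and β. -/

section Bounds

variable {ι γ : Type*} [Fintype ι] [DecidableEq ι]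

theorem card_perm_apply_eq_apply_eq {a b u v : ι} (hab : a ≠ b) (huv : u ≠ v) :
    #{σ : Perm ι | (σ a, σ b) = (u, v)} = (Fintype.card ι - 2).factorial := by
  have hinj : ∀ {x y : ι}, x ≠ y → Function.Injective ![x, y] := by
    intro x y hxy i j
    fin_cases i <;> fin_cases j <;> simp [hxy, hxy.symm]
  have h := card_perm_extending (⟨![a, b], hinj hab⟩ : Fin 2 ↪ ι) ⟨![u, v], hinj huv⟩
  rw [Fintype.card_fin] at h
  rw [← h]
  congr 1
  ext σ
  simp [Fin.forall_fin_two]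

variable [DecidableEq γ]

/-- The quadratic mean of the entries of a column in all rows but two. -/
noncomputable def quadMean (Z : ι → γ → ℂ) (q : ι × ι) (t : γ) : ℝ :=
  √((∑ j ∈ univ \ {q.1, q.2}, ‖Z j t‖ ^ 2) / #(univ \ {q.1, q.2}))

/-- On the permutations with prescribed images (u, v) of the two marked columns the row differences
are constant. This fibre has (N-2)! elements and is stable under transpositions of the other rows,
so the quadratic mean bound applies to it. -/
theorem norm_diffSum_le [Fintype γ] (c : γ ↪ ι) (Z : ι → γ → ℂ) {p : γ × γ} (hp : p.1 ≠ p.2)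
    {L : Finset γ} (hL : L ⊆ univ \ {p.1, p.2}) :
    ‖diffSum c Z p L‖ ≤ (Fintype.card ι - 2).factorial *
      ∑ q ∈ (univ : Finset ι).offDiag,
        ‖(Z q.1 p.1 - Z q.2 p.1) * (Z q.1 p.2 - Z q.2 p.2)‖ * ∏ t ∈ L, quadMean Z q t := by
  refine (norm_sum_le _ _).trans ?_
  rw [← Finset.sum_fiberwise_of_maps_to (s := univ) (t := (univ : Finset ι).offDiag)
    (g := fun σ : Perm ι => (σ (c p.1), σ (c p.2))) (fun σ _ => by simpa using hp),
    Finset.mul_sum]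
  refine Finset.sum_le_sum fun q hq => ?_
  obtain ⟨u, v⟩ := q
  have huv : u ≠ v := (mem_offDiag.1 hq).2.2
  set Ω : Finset (Perm ι) := {σ : Perm ι | (σ (c p.1), σ (c p.2)) = (u, v)} with hΩ
  have hcard : #Ω = (Fintype.card ι - 2).factorial :=
    card_perm_apply_eq_apply_eq (fun h => hp (c.injective h)) huv
  have hmem : ∀ σ, σ ∈ Ω ↔ σ (c p.1) = u ∧ σ (c p.2) = v := fun σ => by simp [hΩ]
  have key := sum_prod_le_card_mul_prod_sqrt c (univ \ {u, v}) L Ω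
    (fun σ hσ x hx y hy => by
      rw [hmem] at hσ ⊢
      simp only [mem_sdiff, mem_univ, true_and, mem_insert, mem_singleton, not_or] at hx hy
      rw [Perm.mul_apply, Perm.mul_apply, hσ.1, hσ.2,
        swap_apply_of_ne_of_ne (Ne.symm hx.1) (Ne.symm hy.1),
        swap_apply_of_ne_of_ne (Ne.symm hx.2) (Ne.symm hy.2)]
      exact ⟨rfl, rfl⟩)
    (fun σ hσ t ht => by
      rw [hmem] at hσ
      have := hL ht
      simp only [mem_sdiff, mem_univ, true_and, mem_insert, mem_singleton, not_or] at this ⊢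
      rw [← hσ.1, ← hσ.2]
      exact ⟨fun h => this.1 (c.injective (σ.injective h)),
        fun h => this.2 (c.injective (σ.injective h))⟩)
    (fun j t => ‖Z j t‖) (fun _ _ => norm_nonneg _)
  rw [hcard] at key
  calc ∑ σ ∈ Ω, ‖(∏ t ∈ L, Z (σ (c t)) t) * ((Z (σ (c p.1)) p.1 - Z (σ (c p.2)) p.1) *
        (Z (σ (c p.1)) p.2 - Z (σ (c p.2)) p.2))‖
      = ‖(Z u p.1 - Z v p.1) * (Z u p.2 - Z v p.2)‖ * ∑ σ ∈ Ω, ∏ t ∈ L, ‖Z (σ (c t)) t‖ := by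
        rw [Finset.mul_sum]
        refine Finset.sum_congr rfl fun σ hσ => ?_
        rw [hmem] at hσ
        rw [hσ.1, hσ.2, norm_mul, norm_prod, mul_comm]
    _ ≤ ‖(Z u p.1 - Z v p.1) * (Z u p.2 - Z v p.2)‖ *
        ((Fintype.card ι - 2).factorial * ∏ t ∈ L, quadMean Z (u, v) t) :=
        mul_le_mul_of_nonneg_left key (norm_nonneg _)
    _ = _ := by ring

variable [Fintype γ]

theorem card_univ_sdiff_pair {α : Type*} [Fintype α] [DecidableEq α] {p : α × α}
    (hp : p.1 ≠ p.2) : #(univ \ {p.1, p.2}) = Fintype.card α - 2 := by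
  rw [card_sdiff_of_subset (subset_univ _), card_univ, card_pair hp]

theorem sum_powersetCard_compl (b : γ → ℝ) {k l : ℕ} (hkl : k + l = Fintype.card γ) :
    ∑ K ∈ powersetCard k univ, ∏ t ∈ Kᶜ, b t = ∑ K ∈ powersetCard l univ, ∏ t ∈ K, b t := by
  refine Finset.sum_bij' (fun K _ => Kᶜ) (fun K _ => Kᶜ) ?_ ?_ ?_ ?_ ?_
  · intro K hK
    simp only [mem_powersetCard, subset_univ, true_and] at hK ⊢
    rw [card_compl]
    omega
  · intro K hK
    simp only [mem_powersetCard, subset_univ, true_and] at hK ⊢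
    rw [card_compl]
    omega
  all_goals simp

/-- Each (k+2)-set is counted once per ordered pair in it, whence (k+2)(k+1); the sum over
complements is the elementary symmetric function of degree `l`. -/
theorem sum_offDiag_sum_prod_compl_le (b : γ → ℝ) (hb : ∀ t, 0 ≤ b t) {k l : ℕ}
    (hkl : k + 2 + l = Fintype.card γ) :
    ∑ p ∈ (univ : Finset γ).offDiag, ∑ L ∈ powersetCard k (univ \ {p.1, p.2}),
        ∏ t ∈ (univ \ {p.1, p.2}) \ L, b t ≤
      ((k : ℝ) + 2) * (k + 1) * (Fintype.card γ).choose (k + 2) *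
        ((∑ t, b t) / Fintype.card γ) ^ l := by
  have h := sum_offDiag_mul_prod_compl k (fun _ _ => (1 : ℝ)) b
  simp only [one_mul] at h
  have h1 : ∑ K ∈ powersetCard (k + 2) (univ : Finset γ), ∑ _p ∈ K.offDiag, ∏ t ∈ Kᶜ, b t =
      ((k : ℝ) + 2) * (k + 1) * ∑ K ∈ powersetCard l univ, ∏ t ∈ K, b t := by
    rw [← sum_powersetCard_compl b hkl, Finset.mul_sum]
    refine Finset.sum_congr rfl fun K hK => ?_
    rw [Finset.sum_const, offDiag_card, (mem_powersetCard.1 hK).2, nsmul_eq_mul,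
      show (k + 2) * (k + 2) - (k + 2) = (k + 2) * (k + 1) by
        rw [Nat.sub_eq_iff_eq_add (by nlinarith)]; ring]
    push_cast
    ring
  rw [← h, h1, mul_assoc (((k : ℝ) + 2) * (k + 1))]
  refine mul_le_mul_of_nonneg_left ?_ (by positivity)
  have h2 := sum_powersetCard_prod_le univ b hb l
  rw [Finset.card_univ] at h2
  rwa [← Nat.choose_symm_of_eq_add hkl.symm] at h2

theorem sum_prod_quadMean_sq_le (Z : ι → γ → ℂ) {q : ι × ι} {p : γ × γ} {κ : ℝ} {k : ℕ}
    (hq : q.1 ≠ q.2) (hp : p.1 ≠ p.2)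
    (hκ : k ≠ 0 → ∑ j ∈ univ \ {q.1, q.2}, ∑ l ∈ univ \ {p.1, p.2}, ‖Z j l‖ ^ 2 ≤
      ((Fintype.card γ - 2 : ℕ) : ℝ) * ((Fintype.card ι - 2 : ℕ) : ℝ) * κ)
    (hκ0 : 0 ≤ κ) :
    ∑ L ∈ powersetCard k (univ \ {p.1, p.2}), (∏ t ∈ L, quadMean Z q t) ^ 2 ≤
      (Fintype.card γ - 2).choose k * κ ^ k := by
  have h := sum_powersetCard_prod_le (univ \ {p.1, p.2}) (fun t => quadMean Z q t ^ 2)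
    (fun _ => sq_nonneg _) k
  simp only [Finset.prod_pow] at h
  refine h.trans ?_
  rw [card_univ_sdiff_pair hp]
  refine mul_le_mul_of_nonneg_left ?_ (by positivity)
  -- For k = 0 no information on κ is needed; this is the only case when n = 2, where κ is a
  -- convention.
  rcases eq_or_ne k 0 with rfl | hk
  · simp
  refine pow_le_pow_left₀ (by positivity) ?_ k
  have hs : ∑ t ∈ univ \ {p.1, p.2}, quadMean Z q t ^ 2 =
      (∑ j ∈ univ \ {q.1, q.2}, ∑ l ∈ univ \ {p.1, p.2}, ‖Z j l‖ ^ 2) /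
        ((Fintype.card ι - 2 : ℕ) : ℝ) := by
    rw [Finset.sum_comm, Finset.sum_div]
    refine Finset.sum_congr rfl fun t _ => ?_
    rw [quadMean, Real.sq_sqrt (by positivity), card_univ_sdiff_pair hq]
  rw [hs]
  refine div_le_of_le_mul₀ (by positivity) hκ0 (div_le_of_le_mul₀ (by positivity)
    (by positivity) ((hκ hk).trans_eq (by ring)))

theorem norm_sum_diffSum_le (c : γ ↪ ι) (Z : ι → γ → ℂ) {κ : ℝ} (hκ0 : 0 ≤ κ) {k l : ℕ}
    (hkl : k + 2 + l = Fintype.card γ)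
    (hκ : k ≠ 0 → ∀ q : ι × ι, q.1 ≠ q.2 → ∀ p : γ × γ, p.1 ≠ p.2 →
      ∑ j ∈ univ \ {q.1, q.2}, ∑ l ∈ univ \ {p.1, p.2}, ‖Z j l‖ ^ 2 ≤
        ((Fintype.card γ - 2 : ℕ) : ℝ) * ((Fintype.card ι - 2 : ℕ) : ℝ) * κ) :
    ‖∑ p ∈ (univ : Finset γ).offDiag, ∑ L ∈ powersetCard k (univ \ {p.1, p.2}),
        diffSum c Z p L * ∏ t ∈ (univ \ {p.1, p.2}) \ L, mean Z t‖ ≤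
      (Fintype.card ι - 2).factorial * √((Fintype.card γ - 2).choose k * κ ^ k) *
        (√(∑ p ∈ (univ : Finset γ).offDiag, (∑ q ∈ (univ : Finset ι).offDiag,
          ‖(Z q.1 p.1 - Z q.2 p.1) * (Z q.1 p.2 - Z q.2 p.2)‖) ^ 2) *
        √(((k : ℝ) + 2) * (k + 1) * (Fintype.card γ).choose (k + 2) *
          ((∑ t, ‖mean Z t‖ ^ 2) / Fintype.card γ) ^ l)) := by
  set a : γ × γ → ℝ := fun p => ∑ q ∈ (univ : Finset ι).offDiag,
    ‖(Z q.1 p.1 - Z q.2 p.1) * (Z q.1 p.2 - Z q.2 p.2)‖ with ha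
  set B : γ × γ → ℝ := fun p => ∑ L ∈ powersetCard k (univ \ {p.1, p.2}),
    ∏ t ∈ (univ \ {p.1, p.2}) \ L, ‖mean Z t‖ ^ 2 with hB
  have hB0 : ∀ p, 0 ≤ B p := fun p =>
    Finset.sum_nonneg fun _ _ => Finset.prod_nonneg fun _ _ => sq_nonneg _
  set C : ℝ := √((Fintype.card γ - 2).choose k * κ ^ k) with hC
  set m : ℝ := ((Fintype.card ι - 2).factorial : ℝ) with hm
  have hone : ∀ p ∈ (univ : Finset γ).offDiag,
      ‖∑ L ∈ powersetCard k (univ \ {p.1, p.2}),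
        diffSum c Z p L * ∏ t ∈ (univ \ {p.1, p.2}) \ L, mean Z t‖ ≤ m * C * (a p * √(B p)) := by
    intro p hp
    have hp := (mem_offDiag.1 hp).2.2
    calc _ ≤ ∑ L ∈ powersetCard k (univ \ {p.1, p.2}), (m * ∑ q ∈ (univ : Finset ι).offDiag,
            ‖(Z q.1 p.1 - Z q.2 p.1) * (Z q.1 p.2 - Z q.2 p.2)‖ * ∏ t ∈ L, quadMean Z q t) *
            ∏ t ∈ (univ \ {p.1, p.2}) \ L, ‖mean Z t‖ := by
          refine (norm_sum_le _ _).trans (Finset.sum_le_sum fun L hL => ?_)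
          rw [norm_mul, norm_prod]
          exact mul_le_mul_of_nonneg_right (norm_diffSum_le c Z hp (mem_powersetCard.1 hL).1)
            (Finset.prod_nonneg fun _ _ => norm_nonneg _)
      _ = ∑ q ∈ (univ : Finset ι).offDiag,
            m * ‖(Z q.1 p.1 - Z q.2 p.1) * (Z q.1 p.2 - Z q.2 p.2)‖ *
            ∑ L ∈ powersetCard k (univ \ {p.1, p.2}), (∏ t ∈ L, quadMean Z q t) *
              ∏ t ∈ (univ \ {p.1, p.2}) \ L, ‖mean Z t‖ := by
          simp only [Finset.mul_sum, Finset.sum_mul]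
          rw [Finset.sum_comm]
          exact Finset.sum_congr rfl fun _ _ => Finset.sum_congr rfl fun _ _ => by ring
      _ ≤ ∑ q ∈ (univ : Finset ι).offDiag,
            m * ‖(Z q.1 p.1 - Z q.2 p.1) * (Z q.1 p.2 - Z q.2 p.2)‖ * (C * √(B p)) := by
          refine Finset.sum_le_sum fun q hq => mul_le_mul_of_nonneg_left ?_ (by positivity)
          have hq := (mem_offDiag.1 hq).2.2
          -- Cauchy–Schwarz over `L` separates the quadratic means (giving κ) from the column means
          -- (giving β).
          refine (Real.sum_mul_le_sqrt_mul_sqrt _ _ _).trans ?_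
          refine mul_le_mul (Real.sqrt_le_sqrt
            (sum_prod_quadMean_sq_le Z hq hp (fun hk => hκ hk q hq p hp) hκ0)) ?_
            (Real.sqrt_nonneg _) (Real.sqrt_nonneg _)
          simp only [hB, Finset.prod_pow]
          exact le_rfl
      _ = m * C * (a p * √(B p)) := by
          rw [← Finset.sum_mul, ← Finset.mul_sum]
          ring
  refine (norm_sum_le _ _).trans ((Finset.sum_le_sum hone).trans ?_)
  rw [← Finset.mul_sum]
  refine mul_le_mul_of_nonneg_left ?_ (by positivity)
  -- Cauchy–Schwarz over the column pairs isolates the square sum in ϑ.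
  refine (Real.sum_mul_le_sqrt_mul_sqrt _ _ _).trans ?_
  refine mul_le_mul_of_nonneg_left (Real.sqrt_le_sqrt ?_) (Real.sqrt_nonneg _)
  simp only [Real.sq_sqrt (hB0 _)]
  exact sum_offDiag_sum_prod_compl_le _ (fun _ => sq_nonneg _) hkl

end Bounds

/-! ### Assembling the constants and the final estimate. -/

theorem norm_interpolant_sub_le {ι γ : Type*} [Fintype ι] [DecidableEq ι] [DecidableEq γ]
    [Fintype γ] (c : γ ↪ ι) (Z : ι → γ → ℂ) {κ : ℝ} (hκ0 : 0 ≤ κ) {k l : ℕ}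
    (hkl : k + 2 + l = Fintype.card γ)
    (hκ : k ≠ 0 → ∀ q : ι × ι, q.1 ≠ q.2 → ∀ p : γ × γ, p.1 ≠ p.2 →
      ∑ j ∈ univ \ {q.1, q.2}, ∑ l ∈ univ \ {p.1, p.2}, ‖Z j l‖ ^ 2 ≤
        ((Fintype.card γ - 2 : ℕ) : ℝ) * ((Fintype.card ι - 2 : ℕ) : ℝ) * κ) :
    ‖interpolant c Z (k + 2) - interpolant c Z (k + 1)‖ ≤
      1 / ((Fintype.card ι : ℝ) * ((Fintype.card ι : ℝ) - 1) *
          √((Fintype.card γ : ℝ) * ((Fintype.card γ : ℝ) - 1))) *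
        √(∑ p ∈ (univ : Finset γ).offDiag, (∑ q ∈ (univ : Finset ι).offDiag,
          ‖(Z q.1 p.1 - Z q.2 p.1) * (Z q.1 p.2 - Z q.2 p.2)‖) ^ 2) /
        (2 * (Fintype.card ι : ℝ)) *
        (((k : ℝ) + 1) * √((∑ t, ‖mean Z t‖ ^ 2) / Fintype.card γ) ^ l * √κ ^ k) := by
  have hmain := norm_sum_diffSum_le c Z hκ0 hkl hκ
  have hle := Fintype.card_le_of_embedding c
  set n := Fintype.card γ with hn
  obtain ⟨M, hM⟩ : ∃ M, Fintype.card ι = M + 2 := ⟨Fintype.card ι - 2, by omega⟩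
  obtain ⟨n', hn'⟩ : ∃ n', n = n' + 2 := ⟨n - 2, by omega⟩
  set S := ∑ p ∈ (univ : Finset γ).offDiag, (∑ q ∈ (univ : Finset ι).offDiag,
          ‖(Z q.1 p.1 - Z q.2 p.1) * (Z q.1 p.2 - Z q.2 p.2)‖) ^ 2
  set β := (∑ t, ‖mean Z t‖ ^ 2) / n
  have hβ : 0 ≤ β := by positivity
  -- Both sides count a (k+2)-set with an ordered pair in it. Hence the two square roots of binomial
  -- expressions multiply to `E / √(n(n-1))`, and `E` cancels against the denominator, leaving the
  -- factor k + 1.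
  have hE : ((k : ℝ) + 2) * (k + 1) * n.choose (k + 2) = (n : ℝ) * (n - 1) * (n - 2).choose k := by
    have h1 := Nat.add_one_mul_choose_eq n' k
    have h2 := Nat.add_one_mul_choose_eq (n' + 1) (k + 1)
    have h1' : ((n' : ℝ) + 1) * n'.choose k = (n' + 1).choose (k + 1) * (k + 1) := by
      exact_mod_cast h1
    have h2' : ((n' : ℝ) + 1 + 1) * (n' + 1).choose (k + 1) =
        (n' + 1 + 1).choose (k + 1 + 1) * (k + 1 + 1) := by
      exact_mod_cast h2
    rw [hn', Nat.add_sub_cancel]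
    push_cast
    linear_combination (-1 : ℝ) * (k + 1) * h2' - ((n' : ℝ) + 2) * h1'
  have hcpos : (0 : ℝ) < n.choose (k + 2) := by
    exact_mod_cast Nat.choose_pos (by omega)
  set E : ℝ := ((k : ℝ) + 2) * (k + 1) * n.choose (k + 2) with hEdef
  have hEpos : 0 < E := by positivity
  have hnn : 0 < (n : ℝ) * (n - 1) := by
    rw [hn']
    push_cast
    have : (0 : ℝ) ≤ n' := Nat.cast_nonneg _
    nlinarith
  have hC : √((n - 2).choose k : ℝ) = √E / √((n : ℝ) * (n - 1)) := by
    rw [← Real.sqrt_div hEpos.le, hE, mul_div_cancel_left₀ _ hnn.ne']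
  have hpow : ∀ (x : ℝ) (i : ℕ), 0 ≤ x → √(x ^ i) = √x ^ i := fun x i hx => by
    rw [Real.sqrt_eq_iff_mul_self_eq (by positivity) (by positivity), ← mul_pow,
      Real.mul_self_sqrt hx]
  rw [Real.sqrt_mul (by positivity), Real.sqrt_mul hEpos.le, hC, hpow _ _ hκ0, hpow _ _ hβ,
    ← sum_offDiag_mul_prod_compl k (diffSum c Z) (mean Z)] at hmain
  rw [interpolant_succ c Z (k := k + 1) (by omega), sub_sub_cancel_left, norm_neg, norm_div]
  have hden : ‖(2 * (Fintype.card ι : ℂ) * (Fintype.card ι).factorial *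
      (((k + 1 : ℕ) + 1) * n.choose (k + 1 + 1)))‖ =
      2 * (Fintype.card ι : ℝ) * ((Fintype.card ι : ℝ) * (Fintype.card ι - 1) * M.factorial) *
        (E / (k + 1)) := by
    have h0 : (2 * (Fintype.card ι : ℂ) * (Fintype.card ι).factorial *
        (((k + 1 : ℕ) + 1) * n.choose (k + 1 + 1))) = ((2 * Fintype.card ι *
          (Fintype.card ι).factorial * ((k + 1 + 1) * n.choose (k + 1 + 1)) : ℕ) : ℂ) := by
      push_cast
      ring
    rw [h0, Complex.norm_natCast, hM, Nat.factorial_succ, Nat.factorial_succ, hEdef]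
    push_cast
    field_simp
    ring
  rw [hden]
  have hM0 : (0 : ℝ) < (Fintype.card ι : ℝ) * (Fintype.card ι - 1) := by
    rw [hM]
    push_cast
    have : (0 : ℝ) ≤ M := Nat.cast_nonneg _
    nlinarith
  have hι : (0 : ℝ) < Fintype.card ι := by
    rw [hM]
    positivity
  have hι1 : (Fintype.card ι : ℝ) - 1 ≠ 0 := (pos_of_mul_pos_right hM0 hι.le).ne'
  have hmf : (0 : ℝ) < M.factorial := by positivity
  rw [show Fintype.card ι - 2 = M by omega] at hmain
  refine (div_le_div_of_nonneg_right hmain (by positivity)).trans_eq ?_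
  have hs : √((n : ℝ) * (n - 1)) ≠ 0 := (Real.sqrt_pos.2 hnn).ne'
  have hEE : √E * √E = E := Real.mul_self_sqrt hEpos.le
  have hEs : √E ≠ 0 := (Real.sqrt_pos.2 hEpos).ne'
  have hk1 : (k : ℝ) + 1 ≠ 0 := by positivity
  generalize √((n : ℝ) * (n - 1)) = s at hs ⊢
  generalize √E = e at hEE hEs ⊢
  rw [← hEE]
  field_simp

theorem norm_permSum_sub_prod_mean_le {ι γ : Type*} [Fintype ι] [DecidableEq ι] [DecidableEq γ]
    [Fintype γ] (c : γ ↪ ι) (Z : ι → γ → ℂ) {κ : ℝ} (hκ0 : 0 ≤ κ) (hn : 2 ≤ Fintype.card γ)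
    (hκ : 3 ≤ Fintype.card γ → ∀ q : ι × ι, q.1 ≠ q.2 → ∀ p : γ × γ, p.1 ≠ p.2 →
      ∑ j ∈ univ \ {q.1, q.2}, ∑ l ∈ univ \ {p.1, p.2}, ‖Z j l‖ ^ 2 ≤
        ((Fintype.card γ - 2 : ℕ) : ℝ) * ((Fintype.card ι - 2 : ℕ) : ℝ) * κ) :
    ‖permSum c Z univ / (Fintype.card ι).factorial - ∏ t, mean Z t‖ ≤
      1 / ((Fintype.card ι : ℝ) * ((Fintype.card ι : ℝ) - 1) *
          √((Fintype.card γ : ℝ) * ((Fintype.card γ : ℝ) - 1))) *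
        √(∑ p ∈ (univ : Finset γ).offDiag, (∑ q ∈ (univ : Finset ι).offDiag,
          ‖(Z q.1 p.1 - Z q.2 p.1) * (Z q.1 p.2 - Z q.2 p.2)‖) ^ 2) /
        (2 * (Fintype.card ι : ℝ)) *
        f (Fintype.card γ) (√((∑ t, ‖mean Z t‖ ^ 2) / Fintype.card γ)) (√κ) := by
  obtain ⟨m, hm⟩ := Nat.exists_eq_add_of_le' hn
  have htel : permSum c Z univ / (Fintype.card ι).factorial - ∏ t, mean Z t =
      ∑ k ∈ range (m + 1), (interpolant c Z (k + 2) - interpolant c Z (k + 1)) := by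
    rw [Finset.sum_range_sub (fun k => interpolant c Z (k + 1)) (m + 1), ← interpolant_card,
      ← interpolant_one c Z (by omega), hm]
  have hf : ∀ x y, f (Fintype.card γ) x y =
      ∑ k ∈ range (m + 1), ((k : ℝ) + 1) * x ^ (m - k) * y ^ k := fun x y => by
    rw [hm, f_add_two]
  rw [htel, hf, Finset.mul_sum]
  refine (norm_sum_le _ _).trans (Finset.sum_le_sum fun k hk => ?_)
  have hk := Finset.mem_range.1 hk
  exact norm_interpolant_sub_le c Z hκ0 (by omega) fun h => hκ (by omega)

theorem kappa_nonneg {N n : ℕ} (hnN : n ≤ N) (Z : Matrix (Fin N) (Fin n) ℂ) : 0 ≤ kappa Z := by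
  unfold kappa
  split_ifs with h
  · have h1 : (3 : ℝ) ≤ n := by exact_mod_cast h
    have h2 : (n : ℝ) ≤ N := by exact_mod_cast hnN
    have h3 : (0 : ℝ) ≤ ((n : ℝ) - 2) * ((N : ℝ) - 2) := mul_nonneg (by linarith) (by linarith)
    exact mul_nonneg (by positivity) (Real.iSup_nonneg fun _ => by positivity)
  · exact zero_le_one

theorem sum_sum_norm_sq_le_mul_kappa {N n : ℕ} (hn : 3 ≤ n) (hnN : n ≤ N)
    (Z : Matrix (Fin N) (Fin n) ℂ) {q : Fin N × Fin N} (hq : q.1 ≠ q.2) {p : Fin n × Fin n}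
    (hp : p.1 ≠ p.2) :
    ∑ j ∈ univ \ {q.1, q.2}, ∑ l ∈ univ \ {p.1, p.2}, ‖Z j l‖ ^ 2 ≤
      ((n - 2 : ℕ) : ℝ) * ((N - 2 : ℕ) : ℝ) * kappa Z := by
  rw [Nat.cast_sub (by omega), Nat.cast_sub (by omega), kappa, if_pos hn]
  have h1 : (3 : ℝ) ≤ n := by exact_mod_cast hn
  have h2 : (n : ℝ) ≤ N := by exact_mod_cast hnN
  have h3 : ((n : ℝ) - 2) * ((N : ℝ) - 2) ≠ 0 :=
    (mul_pos (by linarith) (by linarith)).ne'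
  push_cast
  rw [one_div, mul_inv_cancel_left₀ h3]
  exact le_ciSup (f := fun x : {q : Fin N × Fin N // q.1 ≠ q.2} ×
      {p : Fin n × Fin n // p.1 ≠ p.2} => ∑ j ∈ univ \ {x.1.1.1, x.1.1.2},
        ∑ l ∈ univ \ {x.2.1.1, x.2.1.2}, ‖Z j l‖ ^ 2)
    (Set.finite_range _).bddAbove (⟨q, hq⟩, ⟨p, hp⟩)

end PermanentApprox

theorem mainTheorem1 (N n : ℕ) (hn : 2 ≤ n) (hnN : n ≤ N) (Z : Matrix (Fin N) (Fin n) ℂ) :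
    (∀ x₁ x₂ : ℝ, x₁ ≠ x₂ →
      PermanentApprox.f n x₁ x₂ =
        (((n : ℝ) - 1) * x₂ ^ n - (n : ℝ) * x₁ * x₂ ^ (n - 1) + x₁ ^ n) / (x₂ - x₁) ^ 2) ∧
    ‖((N - n).factorial : ℂ) / (N.factorial : ℂ) * PermanentApprox.per Z -
        ∏ r, PermanentApprox.colMean Z r‖ ≤
      PermanentApprox.vartheta Z / (2 * (N : ℝ)) *
        PermanentApprox.f n (√(PermanentApprox.beta Z)) (√(PermanentApprox.kappa Z)) := by
  refine ⟨fun x₁ x₂ h => PermanentApprox.f_eq_div hn h, ?_⟩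
  have h := PermanentApprox.norm_permSum_sub_prod_mean_le (Fin.castLEEmb hnN) Z
    (PermanentApprox.kappa_nonneg hnN Z) (by simpa using hn) fun h3 q hq p hp => by
      have h3 : 3 ≤ n := by simpa using h3
      simpa using PermanentApprox.sum_sum_norm_sq_le_mul_kappa h3 hnN Z hq hp
  have hper : PermanentApprox.permSum (Fin.castLEEmb hnN) Z Finset.univ =
      ((N - n).factorial : ℂ) * PermanentApprox.per Z := by
    simpa [PermanentApprox.permSum, PermanentApprox.per] using
      PermanentApprox.sum_perm_prod_eq (Fin.castLEEmb hnN) Z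
  have hmean : ∀ t, PermanentApprox.mean Z t = PermanentApprox.colMean Z t := fun t => by
    simp [PermanentApprox.mean, PermanentApprox.colMean, div_eq_inv_mul]
  have hbeta : (∑ t, ‖PermanentApprox.colMean Z t‖ ^ 2) / n = PermanentApprox.beta Z := by
    simp [PermanentApprox.beta, div_eq_inv_mul]
  simp only [hmean, hper, Fintype.card_fin, hbeta] at h
  rwa [div_mul_eq_mul_div]
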